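/- **The problem.** For a connected unweighted graph $G=(V,E)$ and an integer $k\ge 1$, let $$\mathrm{OPT}_k(G)=\min_{S\subseteq V,\ |S|\le k}\ \max_{v\in V}\min_{s\in S} d(v,s).$$ For $\alpha\ge 1$, a set $S\subseteq V$ is an $\alpha$-approximate solution of the $k$-center problem if $|S|\le k$ and every $v\in V$ satisfies $\min_{s\in S} d(v,s)\le \alpha\cdot \mathrm{OPT}_k(G)$. **The model.** In the CONGEST model the nodes of a graph $G$ on $n$ nodes have distinct identifiers in $\{1,\dots,n\}$. A node initially knows its own identifier and those of its neighbors; it may also know $n$ and $k$. The computation proceeds in synchronous rounds. In each round every node sends to each of its neighbors a message of $O(\log n)$ bits, that is, of at most $b\log n$ bits for a constant $b$ (messages to different neighbors may differ), receives the messages of its neighbors and updates its state by unrestricted local computation. At the end each node declares whether it is a center. Nodes may be randomized; private and shared random bits are both allowed. A $T$-round algorithm returns an $\alpha$-approximation for $k$-center if on every connected graph on $n$ nodes, with probability at least $2/3$, the set of nodes declared as centers after $T$ rounds is an $\alpha$-approximate solution. **Theorem.** Any CONGEST algorithm, even a randomized one, that returns an $\alpha$-approximation for the $k$-center problem with $\alpha<4/3$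 must take $\Omega\!\left(\frac{n}{k^2\log^2 n}\right)$ rounds. Precisely: for every $b$ there are a constant $c>0$ and an integer $n_0$, depending only on $b$, such that for all $n\ge n_0$, all $k\ge 1$ and all $1\le\alpha<4/3$, every $T$-round randomized CONGEST algorithm with messages of at most $b\log n$ bits that returns an $\alpha$-approximation for $k$-center on connected graphs on $n$ nodes satisfies $$T\ \ge\ c\cdot\frac{n}{k^2\log^2 n},$$ provided that $T\ge 1$ or $k^2\log^2 n\le n$. (Some such proviso is needed: for $k\ge n$, declaring every node a center takes $T=0$ rounds.) -/

import Mathlib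

open scoped ENNReal

/-! ### The `k`-center problem on unweighted graphs -/

/-- The largest distance from a node of `G` to its nearest node in `S`
(`⊤` if some node cannot reach `S`, in particular if `S` is empty and `V` is not). -/
noncomputable def coverRadius {V : Type} (G : SimpleGraph V) (S : Finset V) : ℕ∞ :=
  ⨆ v : V, ⨅ s ∈ S, G.edist v s

/-- `OPT_k(G)`: the minimum of `coverRadius G S` over all sets `S` of at most `k` nodes. -/
noncomputable def optKCenter {V : Type} (G : SimpleGraph V) (k : ℕ) : ℕ∞ :=
  ⨅ (S : Finset V) (_ : S.card ≤ k), coverRadius G S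

/-- `S` is an `α`-approximate solution of the `k`-center problem on `G`. -/
def IsApproxKCenter {V : Type} (G : SimpleGraph V) (k : ℕ) (α : ℝ) (S : Finset V) : Prop :=
  S.card ≤ k ∧
    ((coverRadius G S : ℕ∞) : ℝ≥0∞) ≤ ENNReal.ofReal α * ((optKCenter G k : ℕ∞) : ℝ≥0∞)

/-! ### The CONGEST model -/

/-- A message of at most `B` bits; the empty string stands for sending nothing. -/
abbrev CongestMessage (B : ℕ) : Type := {m : List Bool // m.length ≤ B}

/-- A (randomized) node program for networks on `n` nodes with identifiers in `Fin n` and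
messages of at most `B` bits. Local computation is unrestricted, and the program may depend on `n`.

`Ω` is the sample space of all random choices of the execution, which every node may read. This
includes private coins (take `Ω = Fin n → R` and let node `v` look at `ω v` only) and deterministic
algorithms (take `Ω = Unit`). -/
structure CongestAlgorithm (n B : ℕ) (Ω : Type) where
  /-- The local states of a node. -/
  State : Type
  /-- The initial state of a node, from its identifier, those of its neighbors, and the coins. -/
  init : (self : Fin n) → (neighbors : Set (Fin n)) → (coins : Ω) → State
  /-- The message sent in a round to the neighbor with the given identifier. -/
  send : State → Fin n → CongestMessage B
  /-- The update at the end of a round, from the messages received in it; the entry of every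
  identifier that is not a neighbor is `none`. -/
  step : State → (Fin n → Option (CongestMessage B)) → State
  /-- Whether the node declares itself a center. -/
  output : State → Bool

namespace CongestAlgorithm

variable {n B : ℕ} {Ω : Type}

open Classical in
/-- The state of every node after `t` synchronous rounds on the network `G`. -/
noncomputable def stateAfter (A : CongestAlgorithm n B Ω) (G : SimpleGraph (Fin n)) (ω : Ω) :
    ℕ → Fin n → A.State
  | 0, v => A.init v (G.neighborSet v) ω
  | t + 1, v =>
      A.step (A.stateAfter G ω t v)
        (fun u => if G.Adj u v then some (A.send (A.stateAfter G ω t u) v) else none)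

/-- The set of nodes that declare themselves centers after `T` rounds. -/
noncomputable def centers (A : CongestAlgorithm n B Ω) (G : SimpleGraph (Fin n)) (ω : Ω) (T : ℕ) :
    Finset (Fin n) :=
  Finset.univ.filter (fun v => A.output (A.stateAfter G ω T v) = true)

/-- On every connected network on `n` nodes, after `T` rounds and with probability at least `2/3`,
the declared centers form an `α`-approximate solution of the `k`-center problem. -/
def ApproximatesKCenter [MeasurableSpace Ω] (A : CongestAlgorithm n B Ω)
    (μ : MeasureTheory.Measure Ω) (k : ℕ) (α : ℝ) (T : ℕ) : Prop :=
  ∀ G : SimpleGraph (Fin n), G.Connected →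
    ∃ E : Set Ω, MeasurableSet E ∧ 2 / 3 ≤ μ E ∧
      ∀ ω ∈ E, IsApproxKCenter G k α (A.centers G ω T)

end CongestAlgorithm

/-!
# A lower bound for approximating `k`-center in the CONGEST model

Finding a common element of two subsets `x`, `y` of an `N`-element set, one held by each of two
parties, requires `Ω(N)` bits of communication, even if the common element is unique. A network on
`O(N)` nodes encodes this problem with only `O(log N)` edges between the two parties' nodes, so that
a `T`-round algorithm yields a protocol with `O(T · log N · log n)` bits, and `T = Ω(n / log² n)`.
This holds for every `k` up to a constant fraction of `n`, which is more than is claimed.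

*Communication.* Choose a random set `D`, a random `x ⊆ D` and a random `y ⊆ Dᶜ`, and overwrite
their bits at an element `i` by `p` and `q`. Write `Π_pq` for the distribution of the transcript.
If `i ∈ D`, then `Π_00` and `Π_10` are its distributions conditioned on a uniform bit of `x`, and a
short transcript predicts few of these bits (`sum_advantage_le`, from a bound on an exponential
moment). So `Π_00` and `Π_10` are close for most `i`, and so are `Π_00` and `Π_01`. The inputs
leading to a transcript form a rectangle, hence `Π_00 Π_11 = Π_01 Π_10` pointwise, and `Π_11` is
close to `Π_00` as well (`plantCount_sub_le`). But a correct protocol answers `i` with constant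
probability under `Π_11`, and under `Π_00` it answers `i` with probability `O(1 / N)` on average
(`sum_find_planted_le`). The random bits of the algorithm are fixed by averaging over the inputs.

*Network.* The elements are the bit strings `i` of length `m`. The potential center `cand i` is
joined to the `left` ends of crossing edges that spell `i`, and `check i` to the `right` ends that
spell the complement of `i`. So `cand i` is at distance `3` from `check j` for `j ≠ i`, and
at distance `3` from `check i` only by way of one more crossing edge, whose ends are joined to
`cand i` if `i ∈ x` and to `check i` if `i ∈ y`. Pendant paths use up the other `k - 1` centers, and
a further path rules out centers that are no potential centers. Hence, if `x` and `y` have a single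
common element `i`, the optimum is at most `3` (`optKCenter_gadget_le`), a solution with a factor
below `4 / 3` has radius at most `3`, and such a solution must contain `cand i` and no other
potential center (`exists_cand_of_coverRadius_le`).
-/

/-! ### Communication complexity of finding a common element -/

/-- The sign `1` of `false` and `-1` of `true`. -/
def boolSign (b : Bool) : ℝ := if b then -1 else 1

lemma sum_exp_signs_le {ι : Type} [Fintype ι] [DecidableEq ι] (h : ι → ℝ) (hh : ∀ i, |h i| ≤ 1)
    (c : ℝ) :
    ∑ z : ι → Bool, Real.exp (c * ∑ i, h i * boolSign (z i)) ≤
      2 ^ Fintype.card ι * Real.exp (c ^ 2 * Fintype.card ι / 2) := by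
  have h1 : ∀ z : ι → Bool, Real.exp (c * ∑ i, h i * boolSign (z i)) =
      ∏ i, Real.exp (c * (h i * boolSign (z i))) := by
    intro z
    rw [Finset.mul_sum, Real.exp_sum]
  simp_rw [h1]
  have h2 := Finset.prod_univ_sum (fun _ : ι => (Finset.univ : Finset Bool))
    (fun i b => Real.exp (c * (h i * boolSign b)))
  rw [Fintype.piFinset_univ] at h2
  rw [← h2]
  have h3 : ∀ i ∈ (Finset.univ : Finset ι), ∑ b : Bool, Real.exp (c * (h i * boolSign b)) ≤
      2 * Real.exp (c ^ 2 / 2) := by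
    intro i _
    have e1 : ∑ b : Bool, Real.exp (c * (h i * boolSign b)) = 2 * Real.cosh (c * h i) := by
      rw [Real.cosh_eq, Fintype.sum_bool]
      simp [boolSign]
      ring
    have e2 := Real.cosh_le_exp_half_sq (c * h i)
    have e3 : (c * h i) ^ 2 / 2 ≤ c ^ 2 / 2 := by
      have : h i ^ 2 ≤ 1 := (sq_le_one_iff_abs_le_one _).2 (hh i)
      nlinarith [sq_nonneg c]
    rw [e1]
    have := Real.exp_le_exp.2 e3
    linarith
  calc _ ≤ ∏ _i : ι, (2 * Real.exp (c ^ 2 / 2)) :=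
        Finset.prod_le_prod (fun i _ => Finset.sum_nonneg fun b _ => (Real.exp_pos _).le) h3
    _ = _ := by
        rw [Finset.prod_const, Finset.card_univ, mul_pow, ← Real.exp_nat_mul]
        congr 2
        ring

/-- Few bits of information about uniform bits `z` predict few of them: if a prediction of the
`z i` is chosen from a family of `|Θ|` fixed ones, its total advantage over guessing is small. -/
lemma sum_advantage_le {ι Θ : Type} [Fintype ι] [DecidableEq ι] [Fintype Θ]
    (f : (ι → Bool) → Θ) (h : Θ → ι → ℝ) (hh : ∀ t i, |h t i| ≤ 1) {c : ℝ} (hc : 0 < c) :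
    ∑ z, ∑ i, h (f z) i * boolSign (z i) ≤
      2 ^ Fintype.card ι *
        ((Real.log (Fintype.card Θ) + c ^ 2 * Fintype.card ι / 2) / c) := by
  set K := Real.log (Fintype.card Θ) + c ^ 2 * Fintype.card ι / 2 with hK
  set F : (ι → Bool) → Θ → ℝ := fun z t => ∑ i, h t i * boolSign (z i) with hF
  have hΘ : (0 : ℝ) < Fintype.card Θ := by
    exact_mod_cast Fintype.card_pos_iff.2 ⟨f fun _ => false⟩
  have h1 : ∀ z, c * F z (f z) - K + 1 ≤ Real.exp (-K) * ∑ t, Real.exp (c * F z t) := by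
    intro z
    calc _ ≤ Real.exp (c * F z (f z) - K) := Real.add_one_le_exp _
      _ = Real.exp (-K) * Real.exp (c * F z (f z)) := by rw [← Real.exp_add]; ring_nf
      _ ≤ _ := by
        refine mul_le_mul_of_nonneg_left ?_ (Real.exp_pos _).le
        exact Finset.single_le_sum (f := fun t => Real.exp (c * F z t))
          (fun t _ => (Real.exp_pos _).le) (Finset.mem_univ _)
  have h2 := Finset.sum_le_sum fun z (_ : z ∈ (Finset.univ : Finset (ι → Bool))) => h1 z
  have h3 : ∑ z, Real.exp (-K) * ∑ t, Real.exp (c * F z t) ≤ 2 ^ Fintype.card ι := by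
    rw [← Finset.mul_sum, Finset.sum_comm]
    calc _ ≤ Real.exp (-K) * ∑ _t : Θ,
          (2 ^ Fintype.card ι * Real.exp (c ^ 2 * Fintype.card ι / 2)) := by
          refine mul_le_mul_of_nonneg_left ?_ (Real.exp_pos _).le
          exact Finset.sum_le_sum fun t _ => sum_exp_signs_le (h t) (hh t) c
      _ = 2 ^ Fintype.card ι := by
          rw [Finset.sum_const, Finset.card_univ, nsmul_eq_mul, Real.exp_neg, hK, Real.exp_add,
            Real.exp_log hΘ]
          field_simp
  simp only [Finset.sum_add_distrib, Finset.sum_sub_distrib, ← Finset.mul_sum, Finset.sum_const,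
    Finset.card_univ, Fintype.card_fun, Fintype.card_bool, nsmul_eq_mul, Nat.cast_pow,
    Nat.cast_ofNat, mul_one] at h2 h3
  have h4 : c * ∑ z, F z (f z) ≤ 2 ^ Fintype.card ι * K := by linarith
  rw [← mul_div_assoc, le_div_iff₀ hc]
  linarith

lemma sum_eq_two_mul_sum_ite {ι : Type} [Fintype ι] [DecidableEq ι] (i : ι) (p : Bool)
    (F : (ι → Bool) → ℝ) (hF : ∀ z b, F (Function.update z i b) = F z) :
    ∑ z, F z = 2 * ∑ z, if z i = p then F z else 0 := by
  have hinv : Function.Involutive fun z : ι → Bool => Function.update z i (!z i) := by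
    intro z
    simp
  have h1 : ∑ z, (if z i = p then F z else 0) = ∑ z, if z i = p then 0 else F z := by
    rw [← Equiv.sum_comp (hinv.toPerm _)]
    refine Finset.sum_congr rfl fun z _ => ?_
    simp only [Function.Involutive.coe_toPerm, Function.update_self, hF]
    cases z i <;> cases p <;> simp
  have h2 : ∑ z, F z = ∑ z, (if z i = p then F z else 0) + ∑ z, if z i = p then 0 else F z := by
    rw [← Finset.sum_add_distrib]
    refine Finset.sum_congr rfl fun z _ => ?_
    split_ifs <;> simp
  rw [h2, ← h1]
  ring

/-- The part of `z` in the set `D`, both given by their indicator functions. -/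
def maskOn {ι : Type} (D z : ι → Bool) : ι → Bool := fun j => D j && z j

/-- The complement of a set given by its indicator function. -/
def flipMask {ι : Type} (D : ι → Bool) : ι → Bool := fun j => !D j

/-- The number of pairs `(z₁, z₂)` for which the transcript `τ` is `t`, on the inputs
`z₁ ∩ D` and `z₂ ∩ Dᶜ` with their bits at `i` overwritten by `p` and `q`. -/
def plantCount {ι Θ : Type} [Fintype ι] [DecidableEq ι] [DecidableEq Θ]
    (τ : (ι → Bool) → (ι → Bool) → Θ) (D : ι → Bool) (i : ι) (p q : Bool) (t : Θ) : ℝ :=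
  ∑ z₁ : ι → Bool, ∑ z₂ : ι → Bool,
    if τ (Function.update (maskOn D z₁) i p) (Function.update (maskOn (flipMask D) z₂) i q) = t
      then 1 else 0

lemma update_maskOn_update {ι : Type} [DecidableEq ι] (D z : ι → Bool) (i : ι) (p b : Bool) :
    Function.update (maskOn (Function.update D i b) z) i p = Function.update (maskOn D z) i p := by
  ext j
  by_cases h : j = i
  · subst h; simp
  · simp [maskOn, h]

lemma maskOn_update {ι : Type} [DecidableEq ι] (D z : ι → Bool) (i : ι) (p : Bool)
    (hD : D i = true) :
    maskOn D (Function.update z i p) = Function.update (maskOn D z) i p := by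
  ext j
  by_cases h : j = i
  · subst h; simp [maskOn, hD]
  · simp [maskOn, h]

lemma update_maskOn_of_false {ι : Type} [DecidableEq ι] (D z : ι → Bool) (i : ι)
    (hD : D i = false) : Function.update (maskOn D z) i false = maskOn D z := by
  rw [Function.update_eq_self_iff]
  simp [maskOn, hD]

lemma flipMask_update {ι : Type} [DecidableEq ι] (D : ι → Bool) (i : ι) (b : Bool) :
    flipMask (Function.update D i b) = Function.update (flipMask D) i (!b) := by
  ext j
  by_cases h : j = i
  · subst h; simp [flipMask]
  · simp [flipMask, h]

lemma flipMask_flipMask {ι : Type} (D : ι → Bool) : flipMask (flipMask D) = D := by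
  ext j; simp [flipMask]

section
variable {ι Θ : Type} [Fintype ι] [DecidableEq ι] [DecidableEq Θ]

lemma plantCount_update (τ : (ι → Bool) → (ι → Bool) → Θ) (D : ι → Bool) (i : ι) (p q b : Bool)
    (t : Θ) : plantCount τ (Function.update D i b) i p q t = plantCount τ D i p q t := by
  simp only [plantCount, flipMask_update, update_maskOn_update]

lemma plantCount_swap (τ : (ι → Bool) → (ι → Bool) → Θ) (D : ι → Bool) (i : ι) (p q : Bool)
    (t : Θ) :
    plantCount τ D i p q t = plantCount (fun y x => τ x y) (flipMask D) i q p t := by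
  simp only [plantCount, flipMask_flipMask]
  exact Finset.sum_comm

lemma plantCount_of_mem (τ : (ι → Bool) → (ι → Bool) → Θ) (D : ι → Bool) (i : ι) (p : Bool)
    (t : Θ) (hD : D i = true) :
    plantCount τ D i p false t = 2 * ∑ z₁ : ι → Bool, ∑ z₂ : ι → Bool,
      if z₁ i = p ∧ τ (maskOn D z₁) (maskOn (flipMask D) z₂) = t then 1 else 0 := by
  have hf : flipMask D i = false := by simp [flipMask, hD]
  simp only [plantCount, update_maskOn_of_false _ _ _ hf, ← maskOn_update _ _ _ _ hD]
  rw [sum_eq_two_mul_sum_ite i p]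
  · congr 1
    refine Finset.sum_congr rfl fun z _ => ?_
    split_ifs with h
    · subst h
      simp
    · simp [h]
  · intro z b
    simp

lemma sum_plantCount [Fintype Θ] (τ : (ι → Bool) → (ι → Bool) → Θ) (D : ι → Bool) (i : ι)
    (p q : Bool) (g : Θ → ℝ) :
    ∑ t, g t * plantCount τ D i p q t = ∑ z₁ : ι → Bool, ∑ z₂ : ι → Bool,
      g (τ (Function.update (maskOn D z₁) i p)
        (Function.update (maskOn (flipMask D) z₂) i q)) := by
  simp only [plantCount, Finset.mul_sum]
  rw [Finset.sum_comm]
  refine Finset.sum_congr rfl fun z₁ _ => ?_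
  rw [Finset.sum_comm]
  refine Finset.sum_congr rfl fun z₂ _ => ?_
  simp

/-- On average over `i`, overwriting the first party's bit at `i` hardly changes the distribution
of a short transcript. -/
lemma sum_plantCount_sub_le [Fintype Θ] (τ : (ι → Bool) → (ι → Bool) → Θ) {c : ℝ} (hc : 0 < c) :
    ∑ i, ∑ D, ∑ t, max 0 (plantCount τ D i false false t - plantCount τ D i true false t) ≤
      4 * (8 ^ Fintype.card ι *
        ((Real.log (Fintype.card Θ) + c ^ 2 * Fintype.card ι / 2) / c)) := by
  set K := (Real.log (Fintype.card Θ) + c ^ 2 * Fintype.card ι / 2) / c with hK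
  -- the prediction of bit `i` in `D` that a transcript suggests, if it suggests `false`
  set h : (ι → Bool) → Θ → ι → ℝ := fun D t i =>
    if D i = true ∧ plantCount τ D i true false t ≤ plantCount τ D i false false t
      then 1 else 0 with hh
  have h1 : ∀ i D, D i = true →
      ∑ t, max 0 (plantCount τ D i false false t - plantCount τ D i true false t) =
      2 * ∑ z₁ : ι → Bool, ∑ z₂ : ι → Bool,
        h D (τ (maskOn D z₁) (maskOn (flipMask D) z₂)) i * boolSign (z₁ i) := by
    intro i D hD
    have e1 : ∀ t, max 0 (plantCount τ D i false false t - plantCount τ D i true false t) =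
        2 * ∑ z₁ : ι → Bool, ∑ z₂ : ι → Bool,
          (if τ (maskOn D z₁) (maskOn (flipMask D) z₂) = t then h D t i * boolSign (z₁ i)
            else 0) := by
      intro t
      have e2 : max 0 (plantCount τ D i false false t - plantCount τ D i true false t) =
          h D t i * (plantCount τ D i false false t - plantCount τ D i true false t) := by
        simp only [hh, hD, true_and]
        split_ifs with hle
        · rw [max_eq_right (by linarith), one_mul]
        · rw [max_eq_left (by linarith), zero_mul]
      rw [e2, plantCount_of_mem τ D i false t hD, plantCount_of_mem τ D i true t hD, ← mul_sub,
        ← Finset.sum_sub_distrib, mul_left_comm, Finset.mul_sum]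
      congr 1
      refine Finset.sum_congr rfl fun z₁ _ => ?_
      rw [← Finset.sum_sub_distrib, Finset.mul_sum]
      refine Finset.sum_congr rfl fun z₂ _ => ?_
      by_cases ht : τ (maskOn D z₁) (maskOn (flipMask D) z₂) = t
      · cases hz : z₁ i <;> simp [ht, boolSign]
      · simp [ht]
    simp_rw [e1, ← Finset.mul_sum]
    congr 1
    rw [Finset.sum_comm]
    refine Finset.sum_congr rfl fun z₁ _ => ?_
    rw [Finset.sum_comm]
    refine Finset.sum_congr rfl fun z₂ _ => ?_
    simp
  have h2 : ∀ i,
      ∑ D, ∑ t, max 0 (plantCount τ D i false false t - plantCount τ D i true false t) =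
      4 * ∑ D, ∑ z₂ : ι → Bool, ∑ z₁ : ι → Bool,
        h D (τ (maskOn D z₁) (maskOn (flipMask D) z₂)) i * boolSign (z₁ i) := by
    intro i
    rw [sum_eq_two_mul_sum_ite i true]
    · rw [show (4 : ℝ) = 2 * 2 by norm_num, mul_assoc]
      congr 1
      rw [Finset.mul_sum]
      refine Finset.sum_congr rfl fun D _ => ?_
      rw [Finset.sum_comm]
      split_ifs with hD
      · exact h1 i D hD
      · simp [hh, hD]
    · intro D b
      simp only [plantCount_update]
  simp_rw [h2, ← Finset.mul_sum]
  refine mul_le_mul_of_nonneg_left ?_ (by norm_num)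
  rw [Finset.sum_comm]
  have h3 : ∀ D ∈ (Finset.univ : Finset (ι → Bool)),
      ∑ i, ∑ z₂ : ι → Bool, ∑ z₁ : ι → Bool,
        h D (τ (maskOn D z₁) (maskOn (flipMask D) z₂)) i * boolSign (z₁ i) ≤
      2 ^ Fintype.card ι * (2 ^ Fintype.card ι * K) := by
    intro D _
    rw [Finset.sum_comm]
    calc _ ≤ ∑ _z₂ : ι → Bool, 2 ^ Fintype.card ι * K := by
          refine Finset.sum_le_sum fun z₂ _ => ?_
          rw [Finset.sum_comm]
          refine sum_advantage_le (fun z₁ => τ (maskOn D z₁) (maskOn (flipMask D) z₂)) (h D) ?_ hc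
          intro t i
          simp only [hh]
          split_ifs <;> simp
      _ = _ := by simp
  refine (Finset.sum_le_sum h3).trans (le_of_eq ?_)
  rw [Finset.sum_const, Finset.card_univ, nsmul_eq_mul]
  simp only [Fintype.card_fun, Fintype.card_bool, Nat.cast_pow, Nat.cast_ofNat]
  rw [show (8 : ℝ) = 2 * 2 * 2 by norm_num, mul_pow, mul_pow]
  ring

/-- `sum_plantCount_sub_le` with the parties exchanged. -/
lemma sum_plantCount_sub_le_second [Fintype Θ] (τ : (ι → Bool) → (ι → Bool) → Θ) {c : ℝ}
    (hc : 0 < c) :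
    ∑ i, ∑ D, ∑ t, max 0 (plantCount τ D i false false t - plantCount τ D i false true t) ≤
      4 * (8 ^ Fintype.card ι *
        ((Real.log (Fintype.card Θ) + c ^ 2 * Fintype.card ι / 2) / c)) := by
  refine le_of_eq_of_le ?_ (sum_plantCount_sub_le (fun y x => τ x y) hc)
  refine Finset.sum_congr rfl fun i _ => ?_
  have hinv : Function.Involutive (flipMask (ι := ι)) := flipMask_flipMask
  rw [← Equiv.sum_comp (hinv.toPerm _)]
  refine Finset.sum_congr rfl fun D _ => ?_
  simp only [Function.Involutive.coe_toPerm]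
  simp only [plantCount_swap τ, flipMask_flipMask]

lemma mul_sub_mul_le_max_add_max {a₀ a₁ b₀ b₁ : ℝ} (ha₁ : 0 ≤ a₁) (hb₀ : 0 ≤ b₀)
    (hb₁ : 0 ≤ b₁) :
    a₀ * b₀ - a₁ * b₁ ≤ max 0 (a₀ * b₀ - a₁ * b₀) + max 0 (a₀ * b₀ - a₀ * b₁) := by
  have m1 := le_max_left 0 (a₀ * b₀ - a₁ * b₀)
  have m2 := le_max_left 0 (a₀ * b₀ - a₀ * b₁)
  have m3 := le_max_right 0 (a₀ * b₀ - a₁ * b₀)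
  have m4 := le_max_right 0 (a₀ * b₀ - a₀ * b₁)
  rcases le_total a₀ a₁ with h | h <;> rcases le_total b₀ b₁ with h' | h'
  · nlinarith [mul_le_mul h h' hb₀ ha₁]
  · nlinarith [mul_le_mul_of_nonneg_right h hb₁]
  · nlinarith [mul_le_mul_of_nonneg_left h' ha₁]
  · nlinarith [mul_nonneg (sub_nonneg.2 h) (sub_nonneg.2 h')]

/-- The counts `N₀₀`, `N₀₁`, `N₁₀`, `N₁₁` of a transcript satisfy `N₀₀ N₁₁ = N₀₁ N₁₀`, as inputs
leading to it form a rectangle. So `N₁₁` cannot be much below `N₀₀` unless `N₀₁` or `N₁₀` is. -/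
lemma plantCount_sub_le (τ : (ι → Bool) → (ι → Bool) → Θ)
    (hτ : ∀ x x' y y', τ x y = τ x' y' → τ x y' = τ x y) (D : ι → Bool) (i : ι) (t : Θ) :
    plantCount τ D i false false t - plantCount τ D i true true t ≤
      max 0 (plantCount τ D i false false t - plantCount τ D i true false t) +
      max 0 (plantCount τ D i false false t - plantCount τ D i false true t) := by
  classical
  set α : Bool → ℝ := fun p => ∑ z₁ : ι → Bool,
    if ∃ y, τ (Function.update (maskOn D z₁) i p) y = t then 1 else 0 with hα
  set β : Bool → ℝ := fun q => ∑ z₂ : ι → Bool,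
    if ∃ x, τ x (Function.update (maskOn (flipMask D) z₂) i q) = t then 1 else 0 with hβ
  have hprod : ∀ p q, plantCount τ D i p q t = α p * β q := by
    intro p q
    simp only [plantCount, hα, hβ, Finset.sum_mul_sum]
    refine Finset.sum_congr rfl fun z₁ _ => Finset.sum_congr rfl fun z₂ _ => ?_
    rw [boole_mul, ← ite_and]
    refine if_congr ⟨fun h => ⟨⟨_, h⟩, ⟨_, h⟩⟩, ?_⟩ rfl rfl
    rintro ⟨⟨y, hy⟩, ⟨x, hx⟩⟩
    rw [hτ _ x y _ (hy.trans hx.symm), hy]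
  have hα0 : ∀ p, 0 ≤ α p := fun p => Finset.sum_nonneg fun z _ => by split_ifs <;> simp
  have hβ0 : ∀ p, 0 ≤ β p := fun p => Finset.sum_nonneg fun z _ => by split_ifs <;> simp
  simp only [hprod]
  exact mul_sub_mul_le_max_add_max (hα0 _) (hβ0 _) (hβ0 _)

/-- Having `i` in neither set occurs with probability `1 / 2` without overwriting, so forcing it at
most doubles the probability of the answer `i`. -/
lemma sum_plantCount_false_le [Fintype Θ] (τ : (ι → Bool) → (ι → Bool) → Θ) (out : Θ → Option ι)
    (D : ι → Bool) (i : ι) :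
    ∑ t, (if out t = some i then 1 else 0) * plantCount τ D i false false t ≤
      2 * ∑ z₁ : ι → Bool, ∑ z₂ : ι → Bool,
        if out (τ (maskOn D z₁) (maskOn (flipMask D) z₂)) = some i then (1 : ℝ) else 0 := by
  have key : ∀ (σ : (ι → Bool) → (ι → Bool) → Θ) (E : ι → Bool), E i = true →
      ∑ t, (if out t = some i then 1 else 0) * plantCount σ E i false false t ≤
      2 * ∑ z₁ : ι → Bool, ∑ z₂ : ι → Bool,
        if out (σ (maskOn E z₁) (maskOn (flipMask E) z₂)) = some i then (1 : ℝ) else 0 := by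
    intro σ E hE
    have hf : flipMask E i = false := by simp [flipMask, hE]
    rw [sum_plantCount σ E i false false (fun t => if out t = some i then 1 else 0)]
    simp only [update_maskOn_of_false _ _ _ hf, ← maskOn_update _ _ _ _ hE]
    rw [sum_eq_two_mul_sum_ite i false]
    · refine mul_le_mul_of_nonneg_left ?_ (by norm_num)
      refine Finset.sum_le_sum fun z _ => ?_
      split_ifs with h
      · rw [← h, Function.update_eq_self]
      · exact Finset.sum_nonneg fun z _ => by split_ifs <;> simp
    · intro z b
      simp
  cases hD : D i
  · have := key (fun y x => τ x y) (flipMask D) (by simp [flipMask, hD])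
    simp only [flipMask_flipMask] at this
    simp only [plantCount_swap τ]
    refine this.trans (le_of_eq ?_)
    rw [Finset.sum_comm]
  · exact key τ D hD

/-- Lower bound for finding the unique common element of two sets: take disjoint random sets and
plant a random common element `i`. A protocol with few transcripts cannot tell the
planted instance from the one in which `i` is in neither set, and there it rarely answers `i`. -/
theorem sum_find_planted_le [Fintype Θ] (τ : (ι → Bool) → (ι → Bool) → Θ)
    (hτ : ∀ x x' y y', τ x y = τ x' y' → τ x y' = τ x y) (out : Θ → Option ι) :
    ∑ i, ∑ D, ∑ z₁ : ι → Bool, ∑ z₂ : ι → Bool,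
      (if out (τ (Function.update (maskOn D z₁) i true)
        (Function.update (maskOn (flipMask D) z₂) i true)) = some i then (1 : ℝ) else 0) ≤
      8 ^ Fintype.card ι *
        (2 + 64 * Real.log (Fintype.card Θ) + Fintype.card ι / 2) := by
  set O : ι → Θ → ℝ := fun i t => if out t = some i then 1 else 0 with hO
  have h1 : ∀ i D, ∑ z₁ : ι → Bool, ∑ z₂ : ι → Bool,
      (if out (τ (Function.update (maskOn D z₁) i true)
        (Function.update (maskOn (flipMask D) z₂) i true)) = some i then (1 : ℝ) else 0) ≤
      2 * ∑ z₁ : ι → Bool, ∑ z₂ : ι → Bool,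
        O i (τ (maskOn D z₁) (maskOn (flipMask D) z₂)) +
      (∑ t, max 0 (plantCount τ D i false false t - plantCount τ D i true false t) +
       ∑ t, max 0 (plantCount τ D i false false t - plantCount τ D i false true t)) := by
    intro i D
    have e1 := sum_plantCount τ D i true true (O i)
    have e2 := sum_plantCount τ D i true true (fun _ => 1)
    have e3 := sum_plantCount τ D i false false (fun _ => 1)
    have e4 := sum_plantCount_false_le τ out D i
    have e5 : ∑ t, (1 - O i t) *
        (plantCount τ D i false false t - plantCount τ D i true true t) ≤
        ∑ t, max 0 (plantCount τ D i false false t - plantCount τ D i true false t) +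
        ∑ t, max 0 (plantCount τ D i false false t - plantCount τ D i false true t) := by
      rw [← Finset.sum_add_distrib]
      refine Finset.sum_le_sum fun t _ => ?_
      have := plantCount_sub_le τ hτ D i t
      have m1 := le_max_left 0 (plantCount τ D i false false t - plantCount τ D i true false t)
      have m2 := le_max_left 0 (plantCount τ D i false false t - plantCount τ D i false true t)
      simp only [hO]
      split_ifs <;> linarith
    simp only [sub_mul, mul_sub, Finset.sum_sub_distrib] at e5
    rw [← e2] at e3
    simp only [hO] at e1 e5 ⊢
    linarith
  have h2 := Finset.sum_le_sum fun i (_ : i ∈ (Finset.univ : Finset ι)) =>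
    Finset.sum_le_sum fun D (_ : D ∈ (Finset.univ : Finset (ι → Bool))) => h1 i D
  refine h2.trans ?_
  simp only [Finset.sum_add_distrib]
  -- with this `c` the terms linear in the number of elements sum up to `1 / 2`, less than `2 / 3`
  have h3 := sum_plantCount_sub_le τ (c := 1 / 8) (by norm_num)
  have h4 := sum_plantCount_sub_le_second τ (c := 1 / 8) (by norm_num)
  have h5 : ∑ i, ∑ D, 2 * ∑ z₁ : ι → Bool, ∑ z₂ : ι → Bool,
        O i (τ (maskOn D z₁) (maskOn (flipMask D) z₂)) ≤ 2 * 8 ^ Fintype.card ι := by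
    simp only [← Finset.mul_sum]
    refine mul_le_mul_of_nonneg_left ?_ (by norm_num)
    rw [Finset.sum_comm]
    calc _ ≤ ∑ _D : ι → Bool, ∑ _z₁ : ι → Bool, ∑ _z₂ : ι → Bool, (1 : ℝ) := by
          refine Finset.sum_le_sum fun D _ => ?_
          rw [Finset.sum_comm]
          refine Finset.sum_le_sum fun z₁ _ => ?_
          rw [Finset.sum_comm]
          refine Finset.sum_le_sum fun z₂ _ => ?_
          simp only [hO]
          cases out (τ (maskOn D z₁) (maskOn (flipMask D) z₂)) <;> simp
      _ = _ := by
          simp only [Finset.sum_const, Finset.card_univ, Fintype.card_fun, Fintype.card_bool,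
            nsmul_eq_mul, Nat.cast_pow, Nat.cast_ofNat, mul_one]
          rw [show (8 : ℝ) = 2 * (2 * 2) by norm_num, mul_pow, mul_pow]
  refine (add_le_add h5 (add_le_add h3 h4)).trans (le_of_eq ?_)
  ring

end

/-! ### The network of a pair of sets -/

/-- Nodes of the network that encodes two sets of bit strings of length `m`. -/
inductive GadgetNode (m k r : ℕ) : Type
  /-- The potential centers, one for each bit string. -/
  | cand (i : Fin m → Bool)
  /-- The first party's end of a crossing edge: one edge for each position and bit value, and a
  further one for the inputs. -/
  | left (l : Option (Fin m × Bool))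
  /-- The second party's end of a crossing edge. -/
  | right (l : Option (Fin m × Bool))
  /-- The node that is far from the potential center of the same string unless the string
  is in both sets. -/
  | check (i : Fin m → Bool)
  /-- A path whose far end forces a center at distance `3`. -/
  | chain (s : Fin 3)
  /-- Long paths, each of which needs a center of its own. -/
  | tail (c : Fin k) (s : Fin 7)
  /-- Further nodes that make up the required number. -/
  | pad (j : Fin r)

namespace GadgetNode

variable {m k r : ℕ}

/-- The kinds of nodes as a disjoint union. -/
def equivSum (m k r : ℕ) : GadgetNode m k r ≃
    ((Fin m → Bool) ⊕ (Fin m → Bool)) ⊕ (Option (Fin m × Bool) ⊕ Option (Fin m × Bool)) ⊕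
      Fin 3 ⊕ (Fin k × Fin 7) ⊕ Fin r where
  toFun
    | cand i => .inl (.inl i)
    | check i => .inl (.inr i)
    | left l => .inr (.inl (.inl l))
    | right l => .inr (.inl (.inr l))
    | chain s => .inr (.inr (.inl s))
    | tail c s => .inr (.inr (.inr (.inl (c, s))))
    | pad j => .inr (.inr (.inr (.inr j)))
  invFun
    | .inl (.inl i) => cand i
    | .inl (.inr i) => check i
    | .inr (.inl (.inl l)) => left l
    | .inr (.inl (.inr l)) => right l
    | .inr (.inr (.inl s)) => chain s
    | .inr (.inr (.inr (.inl (c, s)))) => tail c s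
    | .inr (.inr (.inr (.inr j))) => pad j
  left_inv a := by cases a <;> rfl
  right_inv a := by rcases a with (_ | _) | (_ | _) | _ | ⟨_, _⟩ | _ <;> rfl

noncomputable instance : Fintype (GadgetNode m k r) := Fintype.ofEquiv _ (equivSum m k r).symm

lemma card_eq : Fintype.card (GadgetNode m k r) =
    2 * 2 ^ m + 2 * (2 * m + 1) + 3 + 7 * k + r := by
  rw [Fintype.card_congr (equivSum m k r)]
  simp
  ring

/-- The edges of the network, in one direction. Edges at the nodes of the first party depend on `x`
only, those at `right` and `check` nodes on `y` only. -/
def Edge (x y : (Fin m → Bool) → Bool) : GadgetNode m k r → GadgetNode m k r → Prop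
  | cand i, left (some (j, β)) => i j = β
  | cand i, left none => x i = true
  | left _, left _ => True
  | left l, right l' => l = l'
  | right (some (j, β)), check i => i j ≠ β
  | right none, check i => y i = true
  | cand _, chain s => s = 0
  | chain s, chain s' => s.val + 1 = s'.val
  | chain s, tail _ s' => s = 2 ∧ s' = 0
  | tail c s, tail c' s' => c = c' ∧ s.val + 1 = s'.val
  | left l, pad _ => l = none
  | _, _ => False

/-- The nodes whose edges do not depend on the second input. -/
def IsFirst : GadgetNode m k r → Prop
  | right _ => False
  | check _ => False
  | _ => True

/-- The level of a node; the levels of adjacent nodes differ by at most `1`. -/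
def height : GadgetNode m k r → ℕ
  | check _ => 0
  | right _ => 1
  | left _ => 2
  | pad _ => 1
  | cand _ => 3
  | chain s => 4 + s
  | tail _ s => 7 + s

/-- The distance from the root of the `c`-th tail, within that tail. -/
def depth (c : Fin k) : GadgetNode m k r → ℕ
  | tail c' s => if c' = c then 1 + s else 0
  | _ => 0

open Classical in
/-- A lower bound on the distance to `check j` that is `4` at `cand j`, valid unless `j` is in both
sets. -/
noncomputable def farLevel (y : (Fin m → Bool) → Bool) (j : Fin m → Bool) : GadgetNode m k r → ℕ
  | check i => if i = j then 0 else 2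
  | right (some (l, β)) => if j l = β then 3 else 1
  | right none => if y j = true then 1 else 3
  | left (some (l, β)) => if j l = β then 3 else 2
  | left none => if y j = true then 2 else 3
  | cand i => if i = j then 4 else 3
  | _ => 3

end GadgetNode

open GadgetNode

/-- The network of the sets with indicator functions `x` and `y`. -/
def gadget (m k r : ℕ) (x y : (Fin m → Bool) → Bool) : SimpleGraph (GadgetNode m k r) :=
  SimpleGraph.fromRel (Edge x y)

/-- A function that changes by at most `1` along edges bounds distances from below. -/
lemma SimpleGraph.le_add_edist_of_adj {V : Type} {G : SimpleGraph V} {f : V → ℕ}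
    (hf : ∀ a b, G.Adj a b → f a ≤ f b + 1) (a b : V) : (f a : ℕ∞) ≤ f b + G.edist a b := by
  have hw : ∀ {a b : V} (p : G.Walk a b), f a ≤ f b + p.length := by
    intro a b p
    induction p with
    | nil => simp
    | cons h p ih =>
      have := hf _ _ h
      simp only [SimpleGraph.Walk.length_cons]
      omega
  by_cases h : G.edist a b = ⊤
  · simp [h]
  · obtain ⟨p, hp⟩ := SimpleGraph.exists_walk_of_edist_ne_top h
    rw [← hp]
    exact_mod_cast hw p

lemma le_add_three_of_edist_le {V : Type} {G : SimpleGraph V} {f : V → ℕ}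
    (hf : ∀ a b, G.Adj a b → f a ≤ f b + 1) {a b : V} (h : G.edist a b ≤ 3) : f a ≤ f b + 3 := by
  have h1 := SimpleGraph.le_add_edist_of_adj hf a b
  have h2 : (f a : ℕ∞) ≤ f b + 3 := h1.trans (by gcongr)
  exact_mod_cast h2

section
variable {m k r : ℕ} {x y : (Fin m → Bool) → Bool}

/-- A function on the nodes that changes by at most `1` along each `Edge` is `1`-Lipschitz. -/
lemma gadget_le_of_rel {f : GadgetNode m k r → ℕ}
    (hf : ∀ a b, Edge x y a b → f a ≤ f b + 1 ∧ f b ≤ f a + 1) :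
    ∀ a b, (gadget m k r x y).Adj a b → f a ≤ f b + 1 := by
  intro a b hab
  rcases (SimpleGraph.fromRel_adj _ _ _).1 hab with ⟨_, h | h⟩
  · exact (hf _ _ h).1
  · exact (hf _ _ h).2

lemma gadget_height (a b : GadgetNode m k r) (h : (gadget m k r x y).Adj a b) :
    height a ≤ height b + 1 := by
  refine gadget_le_of_rel ?_ a b h
  intro a b h
  rcases a with _ | (_ | _) | (_ | _) | _ | _ | _ | _ <;>
    rcases b with _ | (_ | _) | (_ | _) | _ | _ | _ | _ <;>
    simp only [Edge, height] at h ⊢ <;> grind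

lemma gadget_depth (c : Fin k) (a b : GadgetNode m k r) (h : (gadget m k r x y).Adj a b) :
    depth c a ≤ depth c b + 1 := by
  refine gadget_le_of_rel ?_ a b h
  intro a b h
  rcases a with _ | (_ | _) | (_ | _) | _ | _ | _ | _ <;>
    rcases b with _ | (_ | _) | (_ | _) | _ | _ | _ | _ <;>
    simp only [Edge, depth] at h ⊢ <;> grind

lemma gadget_farLevel (j : Fin m → Bool) (hj : ¬ (x j = true ∧ y j = true))
    (a b : GadgetNode m k r) (h : (gadget m k r x y).Adj a b) :
    farLevel y j a ≤ farLevel y j b + 1 := by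
  refine gadget_le_of_rel ?_ a b h
  intro a b h
  rcases a with _ | (_ | ⟨_, _⟩) | (_ | ⟨_, _⟩) | _ | _ | _ | _ <;>
    rcases b with _ | (_ | ⟨_, _⟩) | (_ | ⟨_, _⟩) | _ | _ | _ | _ <;>
    simp only [Edge, farLevel] at h ⊢ <;> grind

lemma exists_edist_le_three {V : Type} {G : SimpleGraph V} {S : Finset V}
    (h : coverRadius G S ≤ 3) (v : V) : ∃ s ∈ S, G.edist v s ≤ 3 := by
  by_contra! hc
  have h1 : (4 : ℕ∞) ≤ ⨅ s ∈ S, G.edist v s :=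
    le_iInf₂ fun s hs => by
      have := Order.add_one_le_of_lt (hc s hs)
      exact le_of_eq_of_le (by norm_num) this
  have h2 : (4 : ℕ∞) ≤ 3 := (h1.trans (le_iSup (fun v => ⨅ s ∈ S, G.edist v s) v)).trans h
  exact absurd h2 (by decide)

/-- Each tail needs a center far out, and the one center left can only be a potential center whose
string is in both sets. -/
lemma exists_cand_of_coverRadius_le {S : Finset (GadgetNode m k r)} (hcard : S.card ≤ k + 1)
    (hS : coverRadius (gadget m k r x y) S ≤ 3) :
    ∃ i, x i = true ∧ y i = true ∧ ∀ j, cand j ∈ S ↔ j = i := by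
  classical
  have htail : ∀ c : Fin k, ∃ s : Fin 7, 3 ≤ s.val ∧ (tail c s : GadgetNode m k r) ∈ S := by
    intro c
    obtain ⟨z, hz, hd⟩ := exists_edist_le_three hS (tail c 6)
    have h1 := le_add_three_of_edist_le (gadget_depth c) hd
    rcases z with _ | _ | _ | _ | _ | ⟨c', s⟩ | _ <;> simp [depth] at h1
    split_ifs at h1 with hc
    · exact ⟨s, by omega, hc ▸ hz⟩
    · omega
  choose t ht htS using htail
  set S' : Finset (GadgetNode m k r) := Finset.univ.image fun c => tail c (t c) with hS'
  have hsub : S' ⊆ S := by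
    intro a ha
    obtain ⟨c, _, rfl⟩ := Finset.mem_image.1 ha
    exact htS c
  have hcard' : S'.card = k := by
    rw [hS', Finset.card_image_of_injective, Finset.card_univ, Fintype.card_fin]
    intro c c' h
    simp only [tail.injEq] at h
    exact h.1
  have hone : (S \ S').card ≤ 1 := by
    rw [Finset.card_sdiff_of_subset hsub]
    omega
  have hnot : ∀ a ∈ S, height a ≤ 9 → a ∈ S \ S' := by
    intro a ha hh
    refine Finset.mem_sdiff.2 ⟨ha, fun ha' => ?_⟩
    obtain ⟨c, _, rfl⟩ := Finset.mem_image.1 ha'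
    have := ht c
    simp only [height] at hh
    omega
  have huniq : ∀ a ∈ S, ∀ b ∈ S, height a ≤ 9 → height b ≤ 9 → a = b := fun a ha b hb h h' =>
    Finset.card_le_one.1 hone a (hnot a ha h) b (hnot b hb h')
  obtain ⟨z, hz, hzd⟩ := exists_edist_le_three hS (chain 2)
  have h2 := le_add_three_of_edist_le gadget_height hzd
  rw [SimpleGraph.edist_comm] at hzd
  have h1 := le_add_three_of_edist_le gadget_height hzd
  rw [show height (chain 2 : GadgetNode m k r) = 6 from rfl] at h1 h2
  have hcheck : ∀ j, (gadget m k r x y).edist z (check j) ≤ 3 ∧ height z ≤ 3 := by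
    intro j
    obtain ⟨z', hz', hd⟩ := exists_edist_le_three hS (check j)
    rw [SimpleGraph.edist_comm] at hd
    have h3 := le_add_three_of_edist_le gadget_height hd
    rw [show height (check j : GadgetNode m k r) = 0 from rfl] at h3
    have : z' = z := huniq z' hz' z hz (by omega) (by omega)
    subst this
    exact ⟨hd, by omega⟩
  have h3 := (hcheck fun _ => false).2
  have hheight : height z = 3 := by omega
  rcases z with i | _ | _ | _ | s | ⟨c', s⟩ | _ <;> simp [height] at hheight
  · refine ⟨i, ?_⟩
    have hi : x i = true ∧ y i = true := by
      by_contra hi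
      have := le_add_three_of_edist_le (gadget_farLevel i hi) (hcheck i).1
      simp [farLevel] at this
    refine ⟨hi.1, hi.2, fun j => ⟨fun hj => ?_, fun hj => hj ▸ hz⟩⟩
    have := huniq _ hj _ hz (by simp [height]) (by simp [height])
    simpa using this
  all_goals omega

lemma edist_le_one_of_rel {a b : GadgetNode m k r} (h : Edge x y a b ∨ Edge x y b a ∨ a = b) :
    (gadget m k r x y).edist a b ≤ 1 := by
  rw [SimpleGraph.edist_le_one_iff_adj_or_eq]
  by_cases hab : a = b
  · exact .inr hab
  · exact .inl ((SimpleGraph.fromRel_adj _ _ _).2 ⟨hab, by tauto⟩)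

lemma edist_le_three_of_steps {V : Type} {G : SimpleGraph V} {a b c d : V} (h1 : G.edist a b ≤ 1)
    (h2 : G.edist b c ≤ 1) (h3 : G.edist c d ≤ 1) : G.edist a d ≤ 3 := by
  calc G.edist a d ≤ G.edist a c + G.edist c d := SimpleGraph.edist_triangle
    _ ≤ (G.edist a b + G.edist b c) + G.edist c d := by gcongr; exact SimpleGraph.edist_triangle
    _ ≤ (1 + 1) + 1 := by gcongr
    _ = 3 := by norm_num

lemma edist_cand_le_three (hm : 0 < m) {i : Fin m → Bool} (hx : x i = true) (hy : y i = true)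
    (a : GadgetNode m k r) (ha : ∀ c s, a ≠ tail c s) :
    (gadget m k r x y).edist (cand i) a ≤ 3 := by
  have hself : ∀ b : GadgetNode m k r, (gadget m k r x y).edist b b ≤ 1 := fun b => by simp
  have hil : ∀ j, (gadget m k r x y).edist (cand i) (left (some (j, i j))) ≤ 1 := fun j =>
    edist_le_one_of_rel (.inl (by simp [Edge]))
  have hin : (gadget m k r x y).edist (cand i) (left none) ≤ 1 :=
    edist_le_one_of_rel (.inl (by simp [Edge, hx]))
  have hll : ∀ l l', (gadget m k r x y).edist (left l) (left l') ≤ 1 := fun l l' =>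
    edist_le_one_of_rel (.inl trivial)
  have hlr : ∀ l, (gadget m k r x y).edist (left l) (right l) ≤ 1 := fun l =>
    edist_le_one_of_rel (.inl rfl)
  rcases a with i' | l | l | i' | s | ⟨c, s⟩ | j
  · exact edist_le_three_of_steps (hil ⟨0, hm⟩) (hll _ (some (⟨0, hm⟩, i' ⟨0, hm⟩)))
      (edist_le_one_of_rel (.inr (.inl (by simp [Edge]))))
  · exact edist_le_three_of_steps hin (hll _ l) (hself _)
  · exact edist_le_three_of_steps hin (hll _ l) (hlr _)
  · by_cases hi : i = i'
    · subst hi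
      exact edist_le_three_of_steps hin (hlr _) (edist_le_one_of_rel (.inl (by simp [Edge, hy])))
    · obtain ⟨j, hj⟩ := Function.ne_iff.1 hi
      exact edist_le_three_of_steps (hil j) (hlr _)
        (edist_le_one_of_rel (.inl (by simpa [Edge] using Ne.symm hj)))
  · have h0 : (gadget m k r x y).edist (cand i) (chain 0) ≤ 1 :=
      edist_le_one_of_rel (.inl (by simp [Edge]))
    have h1 : (gadget m k r x y).edist (chain 0) (chain 1) ≤ 1 :=
      edist_le_one_of_rel (.inl (by simp [Edge]))
    have h2 : (gadget m k r x y).edist (chain 1) (chain 2) ≤ 1 :=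
      edist_le_one_of_rel (.inl (by simp [Edge]))
    fin_cases s
    · exact edist_le_three_of_steps h0 (hself _) (hself _)
    · exact edist_le_three_of_steps h0 h1 (hself _)
    · exact edist_le_three_of_steps h0 h1 h2
  · exact absurd rfl (ha c s)
  · exact edist_le_three_of_steps hin (hself _) (edist_le_one_of_rel (.inl (by simp [Edge])))

lemma edist_tail_le_three (c : Fin k) (s : Fin 7) :
    (gadget m k r x y).edist (tail c 3) (tail c s) ≤ 3 := by
  have hself : ∀ b : GadgetNode m k r, (gadget m k r x y).edist b b ≤ 1 := fun b => by simp
  have hs : ∀ s s' : Fin 7, s.val + 1 = s'.val →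
      (gadget m k r x y).edist (tail c s) (tail c s') ≤ 1 := fun s s' h =>
    edist_le_one_of_rel (.inl (by simp [Edge, h]))
  have hs' : ∀ s s' : Fin 7, s.val + 1 = s'.val →
      (gadget m k r x y).edist (tail c s') (tail c s) ≤ 1 := fun s s' h =>
    edist_le_one_of_rel (.inr (.inl (by simp [Edge, h])))
  fin_cases s
  · exact edist_le_three_of_steps (hs' 2 3 rfl) (hs' 1 2 rfl) (hs' 0 1 rfl)
  · exact edist_le_three_of_steps (hs' 2 3 rfl) (hs' 1 2 rfl) (hself _)
  · exact edist_le_three_of_steps (hs' 2 3 rfl) (hself _) (hself _)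
  · exact edist_le_three_of_steps (hself _) (hself _) (hself _)
  · exact edist_le_three_of_steps (hs 3 4 rfl) (hself _) (hself _)
  · exact edist_le_three_of_steps (hs 3 4 rfl) (hs 4 5 rfl) (hself _)
  · exact edist_le_three_of_steps (hs 3 4 rfl) (hs 4 5 rfl) (hs 5 6 rfl)

lemma gadget_connected (hm : 0 < m) {i : Fin m → Bool} (hx : x i = true) (hy : y i = true) :
    (gadget m k r x y).Connected := by
  have h3 : ∀ {a b : GadgetNode m k r}, (gadget m k r x y).edist a b ≤ 3 →
      (gadget m k r x y).Reachable a b := fun h =>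
    SimpleGraph.reachable_of_edist_ne_top (ne_top_of_le_ne_top (by decide) h)
  have hr : ∀ a, (gadget m k r x y).Reachable (cand i) a := by
    intro a
    by_cases ha : ∀ c s, a ≠ tail c s
    · exact h3 (edist_cand_le_three hm hx hy a ha)
    · push Not at ha
      obtain ⟨c, s, rfl⟩ := ha
      have e1 := h3 (edist_cand_le_three (k := k) (r := r) hm hx hy (chain 2) (by simp))
      have e2 : (gadget m k r x y).Reachable (chain 2) (tail c 0) :=
        SimpleGraph.reachable_of_edist_ne_top
          (ne_top_of_le_ne_top (by decide) (edist_le_one_of_rel (.inl (by simp [Edge]))))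
      have e3 := (h3 (edist_tail_le_three (m := m) (r := r) (x := x) (y := y) c 0)).symm
      exact ((e1.trans e2).trans e3).trans (h3 (edist_tail_le_three c s))
  exact { preconnected := fun a b => (hr a).symm.trans (hr b), nonempty := ⟨cand i⟩ }

lemma optKCenter_gadget_le (hm : 0 < m) {i : Fin m → Bool} (hx : x i = true) (hy : y i = true) :
    optKCenter (gadget m k r x y) (k + 1) ≤ 3 := by
  classical
  -- one center in the middle of each tail
  set S : Finset (GadgetNode m k r) := insert (cand i) (Finset.univ.image fun c => tail c 3)
  have hcard : S.card ≤ k + 1 := by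
    refine (Finset.card_insert_le _ _).trans ?_
    have := Finset.card_image_le (s := (Finset.univ : Finset (Fin k)))
      (f := fun c => (tail c 3 : GadgetNode m k r))
    simp only [Finset.card_univ, Fintype.card_fin] at this
    omega
  refine (iInf₂_le S hcard).trans (iSup_le fun v => ?_)
  by_cases hv : ∀ c s, v ≠ tail c s
  · refine (iInf₂_le (cand i) (Finset.mem_insert_self _ _)).trans ?_
    rw [SimpleGraph.edist_comm]
    exact edist_cand_le_three hm hx hy v hv
  · push Not at hv
    obtain ⟨c, s, rfl⟩ := hv
    refine (iInf₂_le (tail c 3) (Finset.mem_insert_of_mem (by simp))).trans ?_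
    rw [SimpleGraph.edist_comm]
    exact edist_tail_le_three c s

end

/-! ### Transfer along relabelings -/

section
variable {V W : Type}

lemma edist_comap_equiv (G : SimpleGraph V) (e : W ≃ V) (a b : W) :
    (G.comap e).edist a b = G.edist (e a) (e b) := by
  have key : ∀ {V W : Type} {G : SimpleGraph V} {H : SimpleGraph W} (f : G →g H) (a b : V),
      H.edist (f a) (f b) ≤ G.edist a b := by
    intro V W G H f a b
    by_cases h : G.edist a b = ⊤
    · simp [h]
    · obtain ⟨p, hp⟩ := SimpleGraph.exists_walk_of_edist_ne_top h
      rw [← hp, ← SimpleGraph.Walk.length_map f p]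
      exact SimpleGraph.edist_le _
  refine le_antisymm ?_ (key (SimpleGraph.Iso.comap e G).toHom a b)
  have := key (SimpleGraph.Iso.comap e G).symm.toHom (e a) (e b)
  simpa using this

lemma coverRadius_comap (G : SimpleGraph V) (e : W ≃ V) (S : Finset W) :
    coverRadius (G.comap e) S = coverRadius G (S.map e.toEmbedding) := by
  unfold coverRadius
  rw [← e.iSup_comp]
  refine iSup_congr fun v => ?_
  simp only [edist_comap_equiv, ← Finset.mem_coe, Finset.coe_map, iInf_image]
  rfl

lemma optKCenter_comap_le (G : SimpleGraph V) (e : W ≃ V) (k : ℕ) :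
    optKCenter (G.comap e) k ≤ optKCenter G k := by
  refine le_iInf₂ fun S hS => ?_
  refine (iInf₂_le (S.map e.symm.toEmbedding) (by simpa using hS)).trans (le_of_eq ?_)
  rw [coverRadius_comap, Finset.map_map]
  congr 1
  ext a
  simp

end

/-- An approximate solution with factor below `4/3` is optimal if the optimum is at most `3`. -/
lemma IsApproxKCenter.coverRadius_le_three {V : Type} {G : SimpleGraph V} {k : ℕ} {α : ℝ}
    {S : Finset V} (h : IsApproxKCenter G k α S) (hα : α < 4 / 3) (hopt : optKCenter G k ≤ 3) :
    coverRadius G S ≤ 3 := by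
  by_contra! hc
  have h4 : (4 : ℕ∞) ≤ coverRadius G S :=
    le_of_eq_of_le (by norm_num) (Order.add_one_le_of_lt hc)
  have h1 : ((4 : ℕ∞) : ℝ≥0∞) ≤ ENNReal.ofReal α * ((3 : ℕ∞) : ℝ≥0∞) := by
    refine le_trans ?_ (h.2.trans ?_)
    · exact_mod_cast h4
    · gcongr
  have h2 : ENNReal.ofReal α * ((3 : ℕ∞) : ℝ≥0∞) < ENNReal.ofReal 4 := by
    have e : ((3 : ℕ∞) : ℝ≥0∞) = ENNReal.ofReal 3 := by
      rw [show (3 : ℕ∞) = ((3 : ℕ) : ℕ∞) by rfl]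
      simp
    rw [e, ← ENNReal.ofReal_mul' (by norm_num)]
    exact (ENNReal.ofReal_lt_ofReal_iff (by norm_num)).2 (by linarith)
  have e : ((4 : ℕ∞) : ℝ≥0∞) = ENNReal.ofReal 4 := by
    rw [show (4 : ℕ∞) = ((4 : ℕ) : ℕ∞) by rfl]
    simp
  rw [e] at h1
  exact absurd h1 (not_le.2 h2)

/-! ### Two-party simulation of a CONGEST algorithm -/

namespace CongestAlgorithm

variable {n B : ℕ} {Ω : Type}

/-- Let `H` agree with `G` around the nodes of `P` and with `G'` around the other nodes. If the runs
on `G` and `G'` send the same messages across the cut, the run on `H` is glued from both. -/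
lemma stateAfter_glue (A : CongestAlgorithm n B Ω) (ω : Ω) (P : Fin n → Prop)
    {G G' H : SimpleGraph (Fin n)} (hG : ∀ v, P v → ∀ u, H.Adj v u ↔ G.Adj v u)
    (hG' : ∀ v, ¬ P v → ∀ u, H.Adj v u ↔ G'.Adj v u) {T : ℕ}
    (hmsg : ∀ t < T, ∀ u v, H.Adj u v → ¬ (P u ↔ P v) →
      A.send (A.stateAfter G ω t u) v = A.send (A.stateAfter G' ω t u) v) :
    ∀ t ≤ T, (∀ v, P v → A.stateAfter H ω t v = A.stateAfter G ω t v) ∧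
      ∀ v, ¬ P v → A.stateAfter H ω t v = A.stateAfter G' ω t v := by
  intro t
  induction t with
  | zero =>
    refine fun _ => ⟨fun v hv => ?_, fun v hv => ?_⟩
    · simp only [stateAfter]
      congr 1
      ext u
      exact hG v hv u
    · simp only [stateAfter]
      congr 1
      ext u
      exact hG' v hv u
  | succ t ih =>
    intro ht
    obtain ⟨ih1, ih2⟩ := ih (by omega)
    refine ⟨fun v hv => ?_, fun v hv => ?_⟩
    · simp only [stateAfter, ih1 v hv]
      congr 1
      ext1 u
      have e : H.Adj u v ↔ G.Adj u v := by rw [H.adj_comm, G.adj_comm, hG v hv u]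
      by_cases hu : H.Adj u v
      · rw [if_pos hu, if_pos (e.1 hu)]
        by_cases hP : P u
        · rw [ih1 u hP]
        · rw [ih2 u hP, hmsg t (by omega) u v hu (by tauto)]
      · rw [if_neg hu, if_neg (e.not.1 hu)]
    · simp only [stateAfter, ih2 v hv]
      congr 1
      ext1 u
      have e : H.Adj u v ↔ G'.Adj u v := by rw [H.adj_comm, G'.adj_comm, hG' v hv u]
      by_cases hu : H.Adj u v
      · rw [if_pos hu, if_pos (e.1 hu)]
        by_cases hP : P u
        · rw [ih1 u hP, hmsg t (by omega) u v hu (by tauto)]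
        · rw [ih2 u hP]
      · rw [if_neg hu, if_neg (e.not.1 hu)]

end CongestAlgorithm

section
variable {m k r : ℕ}

lemma gadget_adj_first (x y y' : (Fin m → Bool) → Bool) (a b : GadgetNode m k r)
    (ha : IsFirst a) : (gadget m k r x y).Adj a b ↔ (gadget m k r x y').Adj a b := by
  simp only [gadget, SimpleGraph.fromRel_adj]
  rcases a with _ | (_ | ⟨_, _⟩) | (_ | ⟨_, _⟩) | _ | _ | _ | _ <;>
    rcases b with _ | (_ | ⟨_, _⟩) | (_ | ⟨_, _⟩) | _ | _ | _ | _ <;>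
    simp only [Edge, IsFirst] at ha ⊢

lemma gadget_adj_second (x x' y : (Fin m → Bool) → Bool) (a b : GadgetNode m k r)
    (ha : ¬ IsFirst a) : (gadget m k r x y).Adj a b ↔ (gadget m k r x' y).Adj a b := by
  simp only [gadget, SimpleGraph.fromRel_adj]
  rcases a with _ | (_ | ⟨_, _⟩) | (_ | ⟨_, _⟩) | _ | _ | _ | _ <;>
    rcases b with _ | (_ | ⟨_, _⟩) | (_ | ⟨_, _⟩) | _ | _ | _ | _ <;>
    simp [Edge, IsFirst] at ha ⊢

lemma exists_eq_left_right (x y : (Fin m → Bool) → Bool) (a b : GadgetNode m k r)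
    (ha : IsFirst a) (hb : ¬ IsFirst b) (h : (gadget m k r x y).Adj a b) :
    ∃ l, a = left l ∧ b = right l := by
  simp only [gadget, SimpleGraph.fromRel_adj] at h
  rcases a with _ | _ | (_ | ⟨_, _⟩) | _ | _ | _ | _ <;>
    rcases b with _ | _ | (_ | ⟨_, _⟩) | _ | _ | _ | _ <;>
    simp [Edge, IsFirst] at ha hb h ⊢ <;> simp [h]

end

/-- The network `gadget m k r x y` with identifiers assigned by `e`. -/
def labeledGadget {n m k r : ℕ} (e : Fin n ≃ GadgetNode m k r) (x y : (Fin m → Bool) → Bool) :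
    SimpleGraph (Fin n) :=
  (gadget m k r x y).comap e

namespace CongestAlgorithm

variable {n B m k r : ℕ} {Ω : Type}

/-- The messages sent across the crossing edges in the first `T` rounds, in both directions. -/
noncomputable def cutTranscript (A : CongestAlgorithm n B Ω) (e : Fin n ≃ GadgetNode m k r) (ω : Ω)
    (T : ℕ) (x y : (Fin m → Bool) → Bool) :
    Fin T → Option (Fin m × Bool) × Bool → CongestMessage B := fun t l =>
  if l.2 then A.send (A.stateAfter (labeledGadget e x y) ω t (e.symm (left l.1)))
      (e.symm (right l.1))
    else A.send (A.stateAfter (labeledGadget e x y) ω t (e.symm (right l.1))) (e.symm (left l.1))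

open Classical in
/-- Some string whose potential center is declared a center, if there is one. -/
noncomputable def foundString (A : CongestAlgorithm n B Ω) (e : Fin n ≃ GadgetNode m k r) (ω : Ω)
    (T : ℕ) (x y : (Fin m → Bool) → Bool) : Option (Fin m → Bool) :=
  if h : ∃ i, A.output (A.stateAfter (labeledGadget e x y) ω T (e.symm (cand i))) = true
    then some h.choose else none

/-- The inputs that lead to a given transcript and answer form a rectangle. -/
lemma transcript_rectangle (A : CongestAlgorithm n B Ω) (e : Fin n ≃ GadgetNode m k r) (ω : Ω)
    (T : ℕ) (x x' y y' : (Fin m → Bool) → Bool)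
    (h : (A.cutTranscript e ω T x y, A.foundString e ω T x y) =
      (A.cutTranscript e ω T x' y', A.foundString e ω T x' y')) :
    (A.cutTranscript e ω T x y', A.foundString e ω T x y') =
      (A.cutTranscript e ω T x y, A.foundString e ω T x y) := by
  have hT := (Prod.ext_iff.1 h).1
  have hleft : ∀ t (ht : t < T) l,
      A.send (A.stateAfter (labeledGadget e x y) ω t (e.symm (left l))) (e.symm (right l)) =
      A.send (A.stateAfter (labeledGadget e x' y') ω t (e.symm (left l))) (e.symm (right l)) :=
    fun t ht l => by simpa [cutTranscript] using congrFun (congrFun hT ⟨t, ht⟩) (l, true)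
  have hright : ∀ t (ht : t < T) l,
      A.send (A.stateAfter (labeledGadget e x y) ω t (e.symm (right l))) (e.symm (left l)) =
      A.send (A.stateAfter (labeledGadget e x' y') ω t (e.symm (right l))) (e.symm (left l)) :=
    fun t ht l => by simpa [cutTranscript] using congrFun (congrFun hT ⟨t, ht⟩) (l, false)
  have hglue := A.stateAfter_glue ω (fun v => IsFirst (e v)) (G := labeledGadget e x y)
    (G' := labeledGadget e x' y') (H := labeledGadget e x y') (T := T)
    (fun v hv u => gadget_adj_first x y' y _ _ hv)
    (fun v hv u => gadget_adj_second x x' y' _ _ hv)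
    (fun t ht u v huv hP => by
      by_cases hu : IsFirst (e u)
      · obtain ⟨l, h1, h2⟩ := exists_eq_left_right x y' (e u) (e v) hu (by tauto) huv
        rw [← e.eq_symm_apply] at h1 h2
        rw [h1, h2]
        exact hleft t ht l
      · obtain ⟨l, h1, h2⟩ := exists_eq_left_right x y' (e v) (e u) (by tauto) hu huv.symm
        rw [← e.eq_symm_apply] at h1 h2
        rw [h1, h2]
        exact hright t ht l)
  have hfirst : ∀ t ≤ T, ∀ a : GadgetNode m k r, IsFirst a →
      A.stateAfter (labeledGadget e x y') ω t (e.symm a) =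
      A.stateAfter (labeledGadget e x y) ω t (e.symm a) := fun t ht a ha =>
    (hglue t ht).1 _ (by simpa using ha)
  have hsecond : ∀ t ≤ T, ∀ a : GadgetNode m k r, ¬ IsFirst a →
      A.stateAfter (labeledGadget e x y') ω t (e.symm a) =
      A.stateAfter (labeledGadget e x' y') ω t (e.symm a) := fun t ht a ha =>
    (hglue t ht).2 _ (by simpa using ha)
  refine Prod.ext ?_ ?_
  · funext t ⟨l, d⟩
    cases d
    · simp only [cutTranscript, Bool.false_eq_true, if_false]
      rw [hsecond t t.2.le _ (by simp [IsFirst]), hright t t.2]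
    · simp only [cutTranscript, if_true]
      rw [hfirst t t.2.le (left l) trivial]
  · simp only [foundString, hfirst T le_rfl (cand _) trivial]

end CongestAlgorithm

/-- A message of at most `B` bits is determined by its entries at `B` positions, each of which is
`0`, `1` or absent. -/
lemma injective_getElem_message (B : ℕ) :
    Function.Injective fun (l : CongestMessage B) (j : Fin B) => l.1[j.val]? := by
  intro l l' h
  refine Subtype.ext (List.ext_getElem? fun j => ?_)
  by_cases hj : j < B
  · exact congrFun h ⟨j, hj⟩
  · rw [List.getElem?_eq_none (by have := l.2; omega),
      List.getElem?_eq_none (by have := l'.2; omega)]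

noncomputable instance (B : ℕ) : Fintype (CongestMessage B) :=
  Fintype.ofInjective _ (injective_getElem_message B)

lemma log_card_message_le (B : ℕ) : Real.log (Fintype.card (CongestMessage B)) ≤ 2 * B := by
  have h1 : Fintype.card (CongestMessage B) ≤ 3 ^ B := by
    refine (Fintype.card_le_of_injective _ (injective_getElem_message B)).trans ?_
    simp
  have h2 : 0 < Fintype.card (CongestMessage B) := Fintype.card_pos_iff.2 ⟨⟨[], by simp⟩⟩
  have h3 : Real.log (Fintype.card (CongestMessage B)) ≤ Real.log ((3 : ℝ) ^ B) :=
    Real.log_le_log (by exact_mod_cast h2) (by exact_mod_cast h1)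
  have h4 := Real.log_le_sub_one_of_pos (show (0 : ℝ) < 3 by norm_num)
  rw [Real.log_pow] at h3
  nlinarith [Nat.cast_nonneg (α := ℝ) B]

/-! ### Fixing the coins -/

open MeasureTheory in
/-- Some choice of the coins succeeds on at least two thirds of the instances. -/
lemma exists_mul_card_le_sum_indicator {Ω κ : Type} [MeasurableSpace Ω] (μ : Measure Ω)
    [IsProbabilityMeasure μ] [Fintype κ] (E : κ → Set Ω) (hE : ∀ a, MeasurableSet (E a))
    (h : ∀ a, 2 / 3 ≤ μ (E a)) :
    ∃ ω, 2 / 3 * (Fintype.card κ : ℝ) ≤ ∑ a, (E a).indicator (fun _ => (1 : ℝ)) ω := by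
  have hint : ∀ a ∈ (Finset.univ : Finset κ),
      Integrable ((E a).indicator (fun _ => (1 : ℝ))) μ :=
    fun a _ => (integrable_const 1).indicator (hE a)
  obtain ⟨ω, hω⟩ := exists_integral_le (integrable_finsetSum _ hint)
  refine ⟨ω, le_trans ?_ (hω.trans (by simp))⟩
  simp only [integral_finsetSum _ hint]
  rw [mul_comm, ← nsmul_eq_mul, ← Finset.card_univ, ← Finset.sum_const]
  refine Finset.sum_le_sum fun a _ => ?_
  rw [integral_indicator_const _ (hE a), smul_eq_mul, mul_one, measureReal_def]
  have := ENNReal.toReal_mono (measure_ne_top μ (E a)) (h a)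
  simpa using this

/-! ### The lower bound -/

/-- On a network whose sets have a single common element, a correct run finds that element. -/
lemma CongestAlgorithm.foundString_eq {n B m k r : ℕ} {Ω : Type} (hm : 0 < m) {α : ℝ}
    (hα : α < 4 / 3) (A : CongestAlgorithm n B Ω) (e : Fin n ≃ GadgetNode m k r) (ω : Ω) (T : ℕ)
    {x y : (Fin m → Bool) → Bool} {i : Fin m → Bool} (hx : x i = true) (hy : y i = true)
    (hxy : ∀ j, x j = true → y j = true → j = i)
    (h : IsApproxKCenter (labeledGadget e x y) (k + 1) α
      (A.centers (labeledGadget e x y) ω T)) : A.foundString e ω T x y = some i := by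
  have hopt : optKCenter (labeledGadget e x y) (k + 1) ≤ 3 :=
    (optKCenter_comap_le _ e _).trans (optKCenter_gadget_le hm hx hy)
  have hr := h.coverRadius_le_three hα hopt
  rw [labeledGadget, coverRadius_comap] at hr
  obtain ⟨i', hx', hy', hi'⟩ := exists_cand_of_coverRadius_le ((Finset.card_map _).trans_le h.1) hr
  obtain rfl := hxy i' hx' hy'
  have hout : ∀ j, A.output (A.stateAfter (labeledGadget e x y) ω T (e.symm (cand j))) = true ↔
      j = i' := by
    intro j
    rw [← hi' j, Finset.mem_map_equiv, centers, Finset.mem_filter]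
    simp [labeledGadget]
  have hex : ∃ i, A.output (A.stateAfter (labeledGadget e x y) ω T (e.symm (cand i))) = true :=
    ⟨i', (hout i').2 rfl⟩
  rw [foundString, dif_pos hex, (hout _).1 hex.choose_spec]

open MeasureTheory in
/-- An algorithm that solves all networks `labeledGadget e x y` yields a protocol for finding a
common element whose transcripts have few bits. -/
theorem two_pow_le_of_approximates {n B m k r T : ℕ} {Ω : Type} [MeasurableSpace Ω]
    (μ : Measure Ω) [IsProbabilityMeasure μ] (A : CongestAlgorithm n B Ω) (hm : 0 < m) {α : ℝ}
    (hα : α < 4 / 3) (e : Fin n ≃ GadgetNode m k r) (hA : A.ApproximatesKCenter μ (k + 1) α T) :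
    (2 : ℝ) ^ m / 6 ≤ 2 + 64 * (T * (2 * (2 * m + 1)) * (2 * B) + Real.log (2 ^ m + 1)) := by
  classical
  set X := Fin m → Bool
  set inX : X × (X → Bool) × (X → Bool) × (X → Bool) → X → Bool := fun a =>
    Function.update (maskOn a.2.1 a.2.2.1) a.1 true with hinX
  set inY : X × (X → Bool) × (X → Bool) × (X → Bool) → X → Bool := fun a =>
    Function.update (maskOn (flipMask a.2.1) a.2.2.2) a.1 true with hinY
  have hx : ∀ a, inX a a.1 = true := fun a => by simp [hinX]
  have hy : ∀ a, inY a a.1 = true := fun a => by simp [hinY]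
  have hxy : ∀ a j, inX a j = true → inY a j = true → j = a.1 := by
    intro a j h1 h2
    by_contra hj
    simp only [hinX, hinY, Function.update_of_ne hj, maskOn, flipMask] at h1 h2
    cases hD : a.2.1 j <;> simp [hD] at h1 h2
  have hconn : ∀ a, (labeledGadget e (inX a) (inY a)).Connected := fun a =>
    (SimpleGraph.Iso.connected_iff (SimpleGraph.Iso.comap e _)).2
      (gadget_connected hm (hx a) (hy a))
  choose E hEm hEμ hE using fun a => hA _ (hconn a)
  obtain ⟨ω, hω⟩ := exists_mul_card_le_sum_indicator μ E hEm hEμ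
  have hle := sum_find_planted_le
    (fun x y => (A.cutTranscript e ω T x y, A.foundString e ω T x y))
    (A.transcript_rectangle e ω T) Prod.snd
  have hsum : ∑ a, (E a).indicator (fun _ => (1 : ℝ)) ω ≤
      ∑ i : X, ∑ D : X → Bool, ∑ z₁ : X → Bool, ∑ z₂ : X → Bool,
        (if A.foundString e ω T (Function.update (maskOn D z₁) i true)
          (Function.update (maskOn (flipMask D) z₂) i true) = some i then (1 : ℝ) else 0) := by
    simp only [Fintype.sum_prod_type]
    refine Finset.sum_le_sum fun i _ => Finset.sum_le_sum fun D _ =>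
      Finset.sum_le_sum fun z₁ _ => Finset.sum_le_sum fun z₂ _ => ?_
    by_cases hmem : ω ∈ E (i, D, z₁, z₂)
    · have := A.foundString_eq hm hα e ω T (hx (i, D, z₁, z₂)) (hy (i, D, z₁, z₂))
        (hxy (i, D, z₁, z₂)) (hE _ ω hmem)
      rw [Set.indicator_of_mem hmem, if_pos this]
    · rw [Set.indicator_of_notMem hmem]
      split_ifs <;> simp
  have hmain := hω.trans (hsum.trans hle)
  have hX : (Fintype.card X : ℝ) = 2 ^ m := by simp [X]
  have hκ : (Fintype.card (X × (X → Bool) × (X → Bool) × (X → Bool)) : ℝ) =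
      8 ^ Fintype.card X * 2 ^ m := by
    rw [← hX]
    simp only [Fintype.card_prod, Fintype.card_fun, Fintype.card_bool, Nat.cast_mul, Nat.cast_pow,
      Nat.cast_ofNat]
    rw [show (8 : ℝ) = 2 * (2 * 2) by norm_num, mul_pow, mul_pow]
    ring
  have hΘ : Real.log (Fintype.card
      ((Fin T → Option (Fin m × Bool) × Bool → CongestMessage B) × Option X)) ≤
      T * (2 * (2 * m + 1)) * (2 * B) + Real.log (2 ^ m + 1) := by
    have hpos : 0 < Fintype.card (CongestMessage B) := Fintype.card_pos_iff.2 ⟨⟨[], by simp⟩⟩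
    rw [Fintype.card_prod, Nat.cast_mul, Real.log_mul
      (Nat.cast_ne_zero.2 (by simp [hpos.ne'])) (Nat.cast_ne_zero.2 (by simp))]
    have e1 : Real.log (Fintype.card (Fin T → Option (Fin m × Bool) × Bool → CongestMessage B)) =
        T * (2 * (2 * m + 1)) * Real.log (Fintype.card (CongestMessage B)) := by
      simp only [Fintype.card_fun, Fintype.card_prod, Fintype.card_option, Fintype.card_bool,
        Fintype.card_fin, Nat.cast_pow, Real.log_pow, Nat.cast_mul, Nat.cast_add, Nat.cast_one,
        Nat.cast_ofNat]
      ring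
    have e2 : (Fintype.card (Option X) : ℝ) = 2 ^ m + 1 := by
      rw [Fintype.card_option, Nat.cast_add, hX, Nat.cast_one]
    rw [e1, e2]
    have := log_card_message_le B
    gcongr
  rw [hκ, hX, mul_left_comm] at hmain
  have h8 : (0 : ℝ) < 8 ^ Fintype.card X := by positivity
  have h9 := le_of_mul_le_mul_left hmain h8
  linarith

theorem mainTheorem1 (b : ℝ) :
    ∃ c : ℝ, 0 < c ∧ ∃ n₀ : ℕ, ∀ (n k B T : ℕ) (α : ℝ),
      n₀ ≤ n → 1 ≤ k → (B : ℝ) ≤ b * Real.log n → 1 ≤ α → α < 4 / 3 →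
      (1 ≤ T ∨ (k : ℝ) ^ 2 * Real.log n ^ 2 ≤ n) →
      ∀ (Ω : Type) [MeasurableSpace Ω] (μ : MeasureTheory.Measure Ω)
        [MeasureTheory.IsProbabilityMeasure μ] (A : CongestAlgorithm n B Ω),
        A.ApproximatesKCenter μ k α T →
        c * ((n : ℝ) / ((k : ℝ) ^ 2 * Real.log n ^ 2)) ≤ T := by
  -- logarithmic terms are negligible from here on
  have hlog : ∀ᶠ n : ℕ in Filter.atTop, Real.log n ≤ n / 24576 := by
    have := (Real.isLittleO_log_id_atTop.comp_tendsto tendsto_natCast_atTop_atTop).bound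
      (show (0 : ℝ) < 1 / 24576 by norm_num)
    filter_upwards [this] with n hn
    simp only [Function.comp_apply, id_eq, Real.norm_eq_abs, Nat.abs_cast] at hn
    linarith [le_abs_self (Real.log n)]
  obtain ⟨n₁, hn₁⟩ := Filter.eventually_atTop.1 hlog
  refine ⟨1 / (245760 * (|b| + 1)), by positivity, max n₁ 1000, ?_⟩
  intro n k B T α hn hk hB _ hα hT Ω _ μ _ A hA
  have hL := hn₁ n (le_of_max_le_left hn)
  have hn1000 : 1000 ≤ n := le_of_max_le_right hn
  have hnR : (1000 : ℝ) ≤ n := by exact_mod_cast hn1000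
  have hkR : (1 : ℝ) ≤ k := by exact_mod_cast hk
  set L := Real.log n with hLdef
  have hL1 : 1 ≤ L := by
    rw [hLdef, Real.le_log_iff_exp_le (by linarith)]
    linarith [Real.exp_one_lt_three]
  have hk2 : (1 : ℝ) ≤ (k : ℝ) ^ 2 := one_le_pow₀ hkR
  have hL2 : (1 : ℝ) ≤ L ^ 2 := one_le_pow₀ hL1
  have hden : 0 < (k : ℝ) ^ 2 * L ^ 2 := by positivity
  by_cases hkn : (k : ℝ) ^ 2 * L ^ 2 ≤ n
  · -- `m` is the largest number of bits for which the nodes indexed by strings take `n / 4` nodes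
    set m := Nat.log 2 (n / 8) with hm
    have hm1 : 2 ^ m ≤ n / 8 := Nat.pow_log_le_self 2 (by omega)
    have hm2 : n / 8 < 2 ^ (m + 1) := Nat.lt_pow_succ_log_self (by norm_num) _
    have hm0 : 0 < m := Nat.log_pos (by norm_num) (by omega)
    have hm3 : n < 16 * 2 ^ m := by
      rw [pow_succ] at hm2
      omega
    have hm4 : 8 * 2 ^ m ≤ n := by omega
    have hm3R : (n : ℝ) < 16 * 2 ^ m := by exact_mod_cast hm3
    have hm4R : (8 : ℝ) * 2 ^ m ≤ n := by exact_mod_cast hm4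
    have hpow : (1 : ℝ) ≤ 2 ^ m := one_le_pow₀ (by norm_num)
    have hmL : (m : ℝ) ≤ 2 * L := by
      have h1 : Real.log ((2 : ℝ) ^ m) ≤ L := Real.log_le_log (by positivity) (by linarith)
      rw [Real.log_pow] at h1
      nlinarith [Real.log_two_gt_d9, Nat.cast_nonneg (α := ℝ) m]
    have hlogm : Real.log (2 ^ m + 1) ≤ L := Real.log_le_log (by positivity) (by linarith)
    have hk28 : 28 * (k : ℝ) ≤ n := by
      by_contra! hc
      nlinarith
    have hfit : 2 * 2 ^ m + 2 * (2 * m + 1) + 3 + 7 * (k - 1) ≤ n := by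
      have : (2 * 2 ^ m + 2 * (2 * m + 1) + 3 + 7 * k : ℝ) ≤ n := by linarith
      have : 2 * 2 ^ m + 2 * (2 * m + 1) + 3 + 7 * k ≤ n := by exact_mod_cast this
      omega
    have e : Fin n ≃ GadgetNode m (k - 1)
        (n - (2 * 2 ^ m + 2 * (2 * m + 1) + 3 + 7 * (k - 1))) := by
      refine Fintype.equivOfCardEq ?_
      rw [GadgetNode.card_eq, Fintype.card_fin]
      omega
    have hmain := two_pow_le_of_approximates μ A hm0 hα e (by rwa [Nat.sub_add_cancel hk])
    have hBL : (B : ℝ) ≤ (|b| + 1) * L := by nlinarith [le_abs_self b]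
    have hprod : (T : ℝ) * (2 * (2 * m + 1)) * (2 * B) ≤ 20 * (|b| + 1) * L ^ 2 * T := by
      calc (T : ℝ) * (2 * (2 * m + 1)) * (2 * B) ≤
          T * (2 * (5 * L)) * (2 * ((|b| + 1) * L)) := by
            gcongr
            linarith
        _ = _ := by ring
    have hfin : (n : ℝ) ≤ 245760 * (|b| + 1) * (L ^ 2 * T) := by nlinarith
    have hb : 0 < 245760 * (|b| + 1) := by positivity
    rw [div_mul_div_comm, one_mul, div_le_iff₀ (by positivity)]
    refine hfin.trans ?_
    have hTk : L ^ 2 * (T : ℝ) ≤ T * (k ^ 2 * L ^ 2) := by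
      have : 0 ≤ L ^ 2 * (T : ℝ) := by positivity
      nlinarith
    calc _ ≤ 245760 * (|b| + 1) * (T * (k ^ 2 * L ^ 2)) := by gcongr
      _ = _ := by ring
  · -- the claimed bound is below `1`
    have hT1 : (1 : ℝ) ≤ T := by exact_mod_cast hT.resolve_right hkn
    have h1 : (n : ℝ) / ((k : ℝ) ^ 2 * L ^ 2) ≤ 1 := by
      rw [div_le_one hden]
      exact (not_le.1 hkn).le
    have h2 : 1 / (245760 * (|b| + 1)) ≤ 1 := by
      rw [div_le_one (by positivity)]
      linarith [abs_nonneg b]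
    have h3 : 0 ≤ (n : ℝ) / ((k : ℝ) ^ 2 * L ^ 2) := by positivity
    have h4 := mul_le_one₀ h2 h3 h1
    linarith
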